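/- Let $K$ be an arbitrary field. A (left) Leibniz algebra over $K$ is a $K$-vector space $L$ with a bilinear product satisfying $a(bc)=(ab)c+b(ac)$ for all $a,b,c\in L$. For subspaces $U,V$ of $L$ let $[U,V]$ be the subspace spanned by all products $uv$ with $u\in U$, $v\in V$, and let $U^1=U$, $U^{n+1}=[U,U^n]$. A subalgebra $U$ is nilpotent if $U^n=0$ for some $n$, and solvable if its derived series $U,\ [U,U],\ [[U,U],[U,U]],\dots$ reaches $0$. $L$ is called minimal nonnilpotent if it is nonnilpotent and solvable and all its proper subalgebras are nilpotent. Let $\mathrm{Leib}(L)$ be the subspace spanned by all squares $xx$, $x\in L$; ideals are two-sided. The core of a subalgebra $M$ is the largest ideal of $L$ contained in $M$, and $M$ is self-normalizing if $M=\{x\in L : xM\subseteq M \text{ and } Mx\subseteq M\}$. For $m\in L$ write $\ell_m(y)=my$. The Fitting null and one-components of $L$ with respect to (left multiplication by) $M$ are $$L_0=\{y\in L : \text{for every } m\in M \text{ there is } k \text{ with } \ell_m^k(y)=0\},\qquad L_1=\sum_{m\in M}\ \bigcap_{k\ge 0}\ell_m^k(L).$$ Let $L$ be a finite-dimensional minimal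 nonnilpotent Leibniz algebra over $K$, let $M$ be a self-normalizing maximal subalgebra of $L$ with core $N$, and let $L_0$, $L_1$ be the Fitting null and one-components of $L$ with respect to $M$. Then $L_0=M$, so that the Fitting decomposition of $L$ with respect to $M$ is $L=M\oplus L_1$, and there is a one-dimensional subspace $F$ of $L$ such that $L$ is the vector space direct sum of $N$, $L_1$ and $F$, and $M=N\oplus F$. Furthermore, the sum $A=N+L_1$ is direct, $A$ is an ideal of $L$, and $A^3=[A,[A,A]]\le \mathrm{Leib}(L)$. -/

import Mathlib

/-- The (left) Leibniz identity `a(bc) = (ab)c + b(ac)`.  A Leibniz algebra over a field `K` is a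
`K`-vector space `L` with a bilinear product (in Mathlib: `NonUnitalNonAssocRing L`, `Module K L`,
`IsScalarTower K L L`, `SMulCommClass K L L`) that satisfies this identity. -/
class IsLeftLeibniz (L : Type*) [NonUnitalNonAssocRing L] : Prop where
  leibniz : ∀ a b c : L, a * (b * c) = (a * b) * c + b * (a * c)

namespace Leibniz

section

variable {K L : Type*} [Field K] [NonUnitalNonAssocRing L] [Module K L]

/-- Two-sided ideals, as subspaces. -/
def IsIdeal (I : Submodule K L) : Prop :=
  ∀ x : L, ∀ a ∈ I, x * a ∈ I ∧ a * x ∈ I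

variable (K L) in
/-- `Leib(L)`, the subspace spanned by all squares. -/
def leib : Submodule K L :=
  Submodule.span K (Set.range fun x : L => x * x)

/-- The core of a subalgebra `M`: the sum of all ideals of `L` contained in `M`, which is the
largest such ideal, see `isGreatest_core`. -/
def core (M : NonUnitalSubalgebra K L) : Submodule K L :=
  sSup {I : Submodule K L | IsIdeal I ∧ I ≤ M.toSubmodule}

theorem isIdeal_sSup {S : Set (Submodule K L)} (hS : ∀ I ∈ S, IsIdeal I) :
    IsIdeal (sSup S) := by
  intro x a ha
  rw [sSup_eq_iSup'] at ha
  rw [sSup_eq_iSup']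
  induction ha using Submodule.iSup_induction' with
  | mem i y hy =>
    exact ⟨Submodule.mem_iSup_of_mem i (hS i i.2 x y hy).1,
      Submodule.mem_iSup_of_mem i (hS i i.2 x y hy).2⟩
  | zero => simp
  | add y z _ _ hy hz =>
    rw [mul_add, add_mul]
    exact ⟨add_mem hy.1 hz.1, add_mem hy.2 hz.2⟩

theorem isGreatest_core (M : NonUnitalSubalgebra K L) :
    IsGreatest {I : Submodule K L | IsIdeal I ∧ I ≤ M.toSubmodule} (core M) :=
  ⟨⟨isIdeal_sSup fun _ h => h.1, sSup_le fun _ h => h.2⟩, fun _ h => le_sSup h⟩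

/-- The (two-sided) normalizer of `M` in `L`, as a set. -/
def normalizer (M : NonUnitalSubalgebra K L) : Set L :=
  {x | ∀ m ∈ M, x * m ∈ M ∧ m * x ∈ M}

/-- `M` is equal to its normalizer. -/
def IsSelfNormalizing (M : NonUnitalSubalgebra K L) : Prop :=
  normalizer M = (M : Set L)

variable [IsScalarTower K L L] [SMulCommClass K L L]

/-- `[U, V]`, the subspace spanned by all products `u * v` with `u ∈ U` and `v ∈ V`. -/
def prod (U V : Submodule K L) : Submodule K L :=
  Submodule.map₂ (LinearMap.mul K L) U V

/-- The lower central series: `lowerCentral U n` is `U ^ (n + 1)`, where `U ^ 1 = U` and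
`U ^ (n + 1) = [U, U ^ n]`. -/
def lowerCentral (U : Submodule K L) : ℕ → Submodule K L
  | 0 => U
  | n + 1 => prod U (lowerCentral U n)

/-- The derived series: `U`, `[U, U]`, `[[U, U], [U, U]]`, ... -/
def derived (U : Submodule K L) : ℕ → Submodule K L
  | 0 => U
  | n + 1 => prod (derived U n) (derived U n)

/-- Nilpotency of a subalgebra (given by its underlying subspace). -/
def IsNilpotent (U : Submodule K L) : Prop := ∃ n, lowerCentral U n = ⊥

/-- Solvability of a subalgebra (given by its underlying subspace). -/
def IsSolvable (U : Submodule K L) : Prop := ∃ n, derived U n = ⊥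

variable (K L) in
/-- `L` is nonnilpotent and solvable, and all its proper subalgebras are nilpotent. -/
structure IsMinimalNonnilpotent : Prop where
  not_nilpotent : ¬ IsNilpotent (⊤ : Submodule K L)
  solvable : IsSolvable (⊤ : Submodule K L)
  nilpotent_of_proper : ∀ S : NonUnitalSubalgebra K L, S ≠ ⊤ → IsNilpotent S.toSubmodule

/-- The Fitting null component of `L` with respect to left multiplication by `M`: all `y` such
that every left multiplication by an element of `M` has a power that annihilates `y`. -/
def fittingNull (M : NonUnitalSubalgebra K L) : Submodule K L :=
  ⨅ m : M, ⨆ k : ℕ, LinearMap.ker (LinearMap.mulLeft K (m : L) ^ k)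

/-- The Fitting one-component of `L` with respect to left multiplication by `M`: the sum, over all
`m ∈ M`, of the Fitting one-components `⋂ k, (ℓ_m) ^ k (L)` of the left multiplications `ℓ_m`. -/
def fittingOne (M : NonUnitalSubalgebra K L) : Submodule K L :=
  ⨆ m : M, ⨅ k : ℕ, LinearMap.range (LinearMap.mulLeft K (m : L) ^ k)

end

end Leibniz

namespace Leibniz

section

set_option linter.unusedSectionVars false

variable {K L : Type*} [Field K] [NonUnitalNonAssocRing L] [Module K L]

/-! An Engel argument (`exists_nullOf_ne_top`) gives `m ∈ M` with ℓ_m not nilpotent on L. As ℓ_m is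
a derivation, its null component is a subalgebra; it contains the nilpotent M, so it equals M by
maximality. Hence L = M ⊕ L₁, where L₁ is the one-component of m alone. A proper subalgebra
containing L₁ and an element that acts on L₁ like m would be nilpotent, forcing L₁ = 0; so any such
subalgebra is L. Solvability gives an ideal B ≥ N outside M with [B,B] ≤ N, and B turns out to be N
+ L₁. Since mm ∈ N, B + Km is a subalgebra, hence L, and F = Km. Finally NL₁ = L₁N = 0 and NN = 0,
so A³ is even 0. -/

theorem isInternal_of_disjoint_of_sup_eq_top {R V : Type*} [Ring R] [AddCommGroup V] [Module R V]
    {P Q F : Submodule R V} (hPF : Disjoint P F) (hQ : Disjoint (P ⊔ F) Q) (h : P ⊔ Q ⊔ F = ⊤) :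
    DirectSum.IsInternal ![P, Q, F] := by
  have d2 : Disjoint P (F ⊔ Q) := hPF.disjoint_sup_right_of_disjoint_sup_left hQ
  have d3 : Disjoint F (P ⊔ Q) :=
    hPF.symm.disjoint_sup_right_of_disjoint_sup_left (sup_comm P F ▸ hQ)
  have hle : ∀ (i : Fin 3) (W : Submodule R V), (∀ j, j ≠ i → ![P, Q, F] j ≤ W) →
      ⨆ (j) (_ : j ≠ i), ![P, Q, F] j ≤ W := fun i W h => iSup₂_le h
  rw [DirectSum.isInternal_submodule_iff_iSupIndep_and_iSup_eq_top]
  refine ⟨fun i => ?_, ?_⟩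
  · fin_cases i
    · refine d2.mono_right (hle 0 _ ?_)
      simp [Fin.forall_fin_succ]
    · refine hQ.symm.mono_right (hle 1 _ ?_)
      simp [Fin.forall_fin_succ]
    · refine d3.mono_right (hle 2 _ ?_)
      simp [Fin.forall_fin_succ]
  · rw [eq_top_iff, ← h]
    exact sup_le (sup_le (le_iSup ![P, Q, F] 0) (le_iSup ![P, Q, F] 1)) (le_iSup ![P, Q, F] 2)

/-! ### Ideals, the core and products of subspaces. -/

theorem IsIdeal.sup {I J : Submodule K L} (hI : IsIdeal I) (hJ : IsIdeal J) :
    IsIdeal (I ⊔ J) := by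
  intro x a ha
  obtain ⟨i, hi, j, hj, rfl⟩ := Submodule.mem_sup.1 ha
  rw [mul_add, add_mul]
  exact ⟨Submodule.add_mem_sup (hI x i hi).1 (hJ x j hj).1,
    Submodule.add_mem_sup (hI x i hi).2 (hJ x j hj).2⟩

theorem isIdeal_core (M : NonUnitalSubalgebra K L) : IsIdeal (core M) :=
  (isGreatest_core M).1.1

theorem core_le (M : NonUnitalSubalgebra K L) : core M ≤ M.toSubmodule :=
  (isGreatest_core M).1.2

theorem le_core {M : NonUnitalSubalgebra K L} {I : Submodule K L} (hI : IsIdeal I)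
    (hIM : I ≤ M.toSubmodule) : I ≤ core M :=
  (isGreatest_core M).2 ⟨hI, hIM⟩

theorem mul_add_mul_mem_leib (x y : L) : x * y + y * x ∈ leib K L := by
  have h (z : L) : z * z ∈ leib K L := Submodule.subset_span ⟨z, rfl⟩
  have e : x * y + y * x = (x + y) * (x + y) - x * x - y * y := by
    simp only [mul_add, add_mul]; abel
  rw [e]
  exact sub_mem (sub_mem (h _) (h _)) (h _)

/-- The sum of an ideal and a subalgebra, as a subalgebra. -/
def IsIdeal.supSubalgebra {I : Submodule K L} (hI : IsIdeal I) (M : NonUnitalSubalgebra K L) :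
    NonUnitalSubalgebra K L :=
  { I ⊔ M.toSubmodule with
    mul_mem' := by
      intro a b ha hb
      obtain ⟨i, hi, j, hj, rfl⟩ := Submodule.mem_sup.1 ha
      obtain ⟨i', hi', j', hj', rfl⟩ := Submodule.mem_sup.1 hb
      have e : (i + j) * (i' + j') = (i * (i' + j') + j * i') + j * j' := by
        simp only [mul_add, add_mul]; abel
      rw [e]
      exact Submodule.add_mem_sup (add_mem (hI _ _ hi).2 (hI _ _ hi').1)
        (M.mul_mem hj hj') }

variable [IsScalarTower K L L] [SMulCommClass K L L]

theorem IsIdeal.sup_eq_top {I : Submodule K L} (hI : IsIdeal I) {M : NonUnitalSubalgebra K L}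
    (hM : IsCoatom M) (h : ¬ I ≤ M.toSubmodule) : I ⊔ M.toSubmodule = ⊤ := by
  have hlt : M < hI.supSubalgebra M := by
    refine lt_of_le_of_ne (fun x hx => ?_) fun e => h fun x hx => ?_
    · exact (le_sup_right : M.toSubmodule ≤ I ⊔ M.toSubmodule) hx
    · change x ∈ M
      rw [e]
      exact (le_sup_left : I ≤ I ⊔ M.toSubmodule) hx
  have ht := hM.2 _ hlt
  refine eq_top_iff.2 fun x _ => ?_
  have hx : x ∈ hI.supSubalgebra M := ht ▸ NonUnitalAlgebra.mem_top
  exact hx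

theorem mul_mem_prod {U V : Submodule K L} {u v : L} (hu : u ∈ U) (hv : v ∈ V) :
    u * v ∈ prod U V :=
  Submodule.apply_mem_map₂ (LinearMap.mul K L) hu hv

theorem prod_le {U V W : Submodule K L} : prod U V ≤ W ↔ ∀ u ∈ U, ∀ v ∈ V, u * v ∈ W :=
  Submodule.map₂_le

/-- The sum of an ideal and the line through an element whose square lies in the ideal. -/
def IsIdeal.supSpanSubalgebra {I : Submodule K L} (hI : IsIdeal I) (m : L) (hm : m * m ∈ I) :
    NonUnitalSubalgebra K L :=
  { I ⊔ Submodule.span K {m} with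
    mul_mem' := by
      intro a b ha hb
      obtain ⟨i, hi, j, hj, rfl⟩ := Submodule.mem_sup.1 ha
      obtain ⟨i', hi', j', hj', rfl⟩ := Submodule.mem_sup.1 hb
      obtain ⟨c, rfl⟩ := Submodule.mem_span_singleton.1 hj
      obtain ⟨c', rfl⟩ := Submodule.mem_span_singleton.1 hj'
      have e : (i + c • m) * (i' + c' • m) =
          i * (i' + c' • m) + (c • m) * i' + c' • c • (m * m) := by
        simp only [mul_add, add_mul, smul_mul_assoc, mul_smul_comm, smul_add]; abel
      rw [e]
      exact (le_sup_left : I ≤ I ⊔ _) (add_mem (add_mem (hI _ _ hi).2 (hI _ _ hi').1)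
        (I.smul_mem _ (I.smul_mem _ hm))) }

/-- Turns nilpotency of a subalgebra into nilpotency of its left multiplications; `lowerCentral U k`
is U^(k+1), which matches k factors x. -/
theorem mulLeft_pow_mem_lowerCentral {U : Submodule K L} {x y : L} (hx : x ∈ U) (hy : y ∈ U)
    (k : ℕ) : (LinearMap.mulLeft K x ^ k) y ∈ lowerCentral U k := by
  induction k with
  | zero => exact hy
  | succ k ih =>
    rw [pow_succ', Module.End.mul_apply]
    exact mul_mem_prod hx ih

/-! ### Fitting decomposition for one left multiplication. -/

/-- The Fitting null component of a left multiplication. -/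
def nullOf (m : L) : Submodule K L := ⨆ k : ℕ, LinearMap.ker (LinearMap.mulLeft K m ^ k)

/-- The Fitting one-component of a left multiplication. -/
def oneOf (m : L) : Submodule K L := ⨅ k : ℕ, LinearMap.range (LinearMap.mulLeft K m ^ k)

theorem mem_nullOf {m y : L} :
    y ∈ nullOf (K := K) m ↔ ∃ k, (LinearMap.mulLeft K m ^ k) y = 0 := by
  unfold nullOf
  rw [Submodule.mem_iSup_of_directed]
  · simp
  · exact (LinearMap.iterateKer (LinearMap.mulLeft K m)).monotone.directed_le

theorem isCompl_nullOf_oneOf [FiniteDimensional K L] (m : L) :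
    IsCompl (nullOf (K := K) m) (oneOf m) :=
  LinearMap.isCompl_iSup_ker_pow_iInf_range_pow _

theorem mul_mem_oneOf {m y : L} (hy : y ∈ oneOf (K := K) m) : m * y ∈ oneOf (K := K) m := by
  simp only [oneOf, Submodule.mem_iInf, LinearMap.mem_range] at hy ⊢
  intro k
  obtain ⟨z, rfl⟩ := hy k
  refine ⟨m * z, ?_⟩
  rw [← LinearMap.mulLeft_apply (R := K), ← LinearMap.mulLeft_apply (R := K),
    ← Module.End.mul_apply, ← Module.End.mul_apply, ← pow_succ, ← pow_succ']

/-- The kernel of ℓ_m lies in the null component, so ℓ_m is injective on the one-component, hence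
surjective there by finite dimension. -/
theorem exists_mul_eq_of_mem_oneOf [FiniteDimensional K L] {m y : L}
    (hy : y ∈ oneOf (K := K) m) : ∃ z ∈ oneOf (K := K) m, m * z = y := by
  have hle : ∀ z ∈ oneOf (K := K) m, LinearMap.mulLeft K m z ∈ oneOf (K := K) m :=
    fun z hz => mul_mem_oneOf hz
  have hinj : Function.Injective ((LinearMap.mulLeft K m).restrict hle) := by
    rw [← LinearMap.ker_eq_bot, LinearMap.ker_eq_bot']
    rintro ⟨z, hz⟩ h0
    have h1 : m * z = 0 := congrArg Subtype.val h0
    have h2 : z ∈ nullOf (K := K) m := mem_nullOf.2 ⟨1, by simpa using h1⟩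
    exact Subtype.ext ((Submodule.disjoint_def.1 (isCompl_nullOf_oneOf m).disjoint) z h2 hz)
  obtain ⟨⟨z, hz⟩, h⟩ := LinearMap.surjective_of_injective hinj ⟨y, hy⟩
  exact ⟨z, hz, congrArg Subtype.val h⟩

/-- If `B` is a subspace invariant under left multiplication by `m` and `U ⊔ B = ⊤`, where `m`
acts nilpotently on `U`, then `B` contains the Fitting one-component. -/
theorem oneOf_le {m : L} {U B : Submodule K L} (hUB : B ⊔ U = ⊤) (hB : ∀ b ∈ B, m * b ∈ B)
    {k : ℕ} (hU : ∀ u ∈ U, (LinearMap.mulLeft K m ^ k) u = 0) : oneOf (K := K) m ≤ B := by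
  intro y hy
  simp only [oneOf, Submodule.mem_iInf, LinearMap.mem_range] at hy
  obtain ⟨z, rfl⟩ := hy k
  obtain ⟨b, hb, u, hu, rfl⟩ := Submodule.mem_sup.1 (hUB ▸ Submodule.mem_top : z ∈ B ⊔ U)
  rw [map_add, hU u hu, add_zero]
  have h (j : ℕ) : (LinearMap.mulLeft K m ^ j) b ∈ B := by
    induction j with
    | zero => simpa using hb
    | succ j ih =>
      rw [pow_succ', Module.End.mul_apply]
      exact hB _ ih
  exact h k

/-! ### Consequences of the Leibniz identity. -/

variable [IsLeftLeibniz L]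

theorem mul_mul_eq (a b c : L) : (a * b) * c = a * (b * c) - b * (a * c) := by
  rw [IsLeftLeibniz.leibniz a b c]; abel

theorem leib_mul {z : L} (hz : z ∈ leib K L) (y : L) : z * y = 0 := by
  induction hz using Submodule.span_induction with
  | mem z h =>
    obtain ⟨x, rfl⟩ := h
    simp [mul_mul_eq]
  | zero => simp
  | add a b _ _ ha hb => rw [add_mul, ha, hb, add_zero]
  | smul c a _ ha => rw [smul_mul_assoc, ha, smul_zero]

variable (K L) in
theorem isIdeal_leib : IsIdeal (leib K L) := by
  intro x z hz
  refine ⟨?_, by rw [leib_mul hz]; exact zero_mem _⟩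
  induction hz using Submodule.span_induction with
  | mem z h =>
    obtain ⟨y, rfl⟩ := h
    change x * (y * y) ∈ _
    rw [IsLeftLeibniz.leibniz]
    exact mul_add_mul_mem_leib _ _
  | zero => simp
  | add a b _ _ ha hb => rw [mul_add]; exact add_mem ha hb
  | smul c a _ ha => rw [mul_smul_comm]; exact Submodule.smul_mem _ _ ha

theorem IsIdeal.prod_self {I : Submodule K L} (hI : IsIdeal I) : IsIdeal (prod I I) := by
  intro x a ha
  have h1 : prod I I ≤ (prod I I).comap (LinearMap.mulLeft K x) := by
    refine prod_le.2 fun u hu v hv => ?_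
    rw [Submodule.mem_comap, LinearMap.mulLeft_apply, IsLeftLeibniz.leibniz]
    exact add_mem (mul_mem_prod (hI x u hu).1 hv) (mul_mem_prod hu (hI x v hv).1)
  have h2 : prod I I ≤ (prod I I).comap (LinearMap.mulRight K x) := by
    refine prod_le.2 fun u hu v hv => ?_
    rw [Submodule.mem_comap, LinearMap.mulRight_apply, mul_mul_eq]
    exact sub_mem (mul_mem_prod hu (hI x v hv).2) (mul_mem_prod hv (hI x u hu).2)
  exact ⟨h1 ha, h2 ha⟩

variable (K L) in
theorem isIdeal_derived (k : ℕ) : IsIdeal (derived (⊤ : Submodule K L) k) := by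
  induction k with
  | zero => exact fun _ _ _ => ⟨Submodule.mem_top, Submodule.mem_top⟩
  | succ k ih => exact ih.prod_self

/-- The left annihilator of an ideal. -/
def leftAnnihilator (N : Submodule K L) : Submodule K L where
  carrier := {x | ∀ n ∈ N, x * n = 0}
  add_mem' ha hb n hn := by rw [add_mul, ha n hn, hb n hn, add_zero]
  zero_mem' n _ := zero_mul n
  smul_mem' c x hx n hn := by rw [smul_mul_assoc, hx n hn, smul_zero]

theorem IsIdeal.leftAnnihilator {N : Submodule K L} (hN : IsIdeal N) :
    IsIdeal (leftAnnihilator N) := by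
  intro x a ha
  constructor <;> intro n hn <;>
    rw [mul_mul_eq, ha n hn, ha _ (hN x n hn).1, mul_zero, sub_zero]

/-- One application of the derivation ℓ_m to yz lowers either i or j, so induction on i + j replaces
the binomial formula. -/
theorem mul_eq_zero_of_pow {m : L} (k : ℕ) : ∀ (i j : ℕ), i + j = k → ∀ y z : L,
    (LinearMap.mulLeft K m ^ i) y = 0 → (LinearMap.mulLeft K m ^ j) z = 0 →
    (LinearMap.mulLeft K m ^ k) (y * z) = 0 := by
  induction k with
  | zero =>
    intro i j h y z hy _
    obtain rfl : i = 0 := by omega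
    simp only [pow_zero, Module.End.one_apply] at hy ⊢
    simp [hy]
  | succ k ih =>
    intro i j h y z hy hz
    rcases i with _ | i
    · simp only [pow_zero, Module.End.one_apply] at hy
      simp [hy]
    rcases j with _ | j
    · simp only [pow_zero, Module.End.one_apply] at hz
      simp [hz]
    rw [pow_succ, Module.End.mul_apply, LinearMap.mulLeft_apply, IsLeftLeibniz.leibniz, map_add,
      ih i (j + 1) (by omega) (m * y) z (by rwa [pow_succ, Module.End.mul_apply] at hy) hz,
      ih (i + 1) j (by omega) y (m * z) hy (by rwa [pow_succ, Module.End.mul_apply] at hz),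
      add_zero]

variable (K) in
/-- The Fitting null component of a left multiplication, as a subalgebra. -/
def nullSubalgebra (m : L) : NonUnitalSubalgebra K L :=
  { nullOf (K := K) m with
    mul_mem' := by
      intro y z hy hz
      obtain ⟨i, hi⟩ := mem_nullOf.1 hy
      obtain ⟨j, hj⟩ := mem_nullOf.1 hz
      exact mem_nullOf.2 ⟨i + j, mul_eq_zero_of_pow _ i j rfl y z hi hj⟩ }

/-- Write z = mw. Then y(mw) = m(yw) - (my)w, where yw has smaller k and my smaller n; likewise on
the other side. -/
theorem mul_mem_range_of_null_of_one [FiniteDimensional K L] {m : L} (n : ℕ) :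
    ∀ (k : ℕ) (y z : L), (LinearMap.mulLeft K m ^ n) y = 0 → z ∈ oneOf (K := K) m →
      y * z ∈ LinearMap.range (LinearMap.mulLeft K m ^ k) ∧
      z * y ∈ LinearMap.range (LinearMap.mulLeft K m ^ k) := by
  induction n with
  | zero =>
    intro k y z hy _
    simp only [pow_zero, Module.End.one_apply] at hy
    simp [hy]
  | succ n ihn =>
    intro k
    induction k with
    | zero => intro y z _ _; simp
    | succ k ihk =>
      intro y z hy hz
      obtain ⟨w, hw, rfl⟩ := exists_mul_eq_of_mem_oneOf hz
      have hy' : (LinearMap.mulLeft K m ^ n) (m * y) = 0 := by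
        rwa [pow_succ, Module.End.mul_apply] at hy
      have h1 := ihn (k + 1) (m * y) w hy' hw
      have h2 := ihk y w hy hw
      have step : ∀ v ∈ LinearMap.range (LinearMap.mulLeft K m ^ k),
          m * v ∈ LinearMap.range (LinearMap.mulLeft K m ^ (k + 1)) := by
        rintro _ ⟨u, rfl⟩
        exact ⟨u, by rw [pow_succ', Module.End.mul_apply]; rfl⟩
      have e1 : y * (m * w) = m * (y * w) - (m * y) * w := by
        rw [IsLeftLeibniz.leibniz m y w]; abel
      have e2 : (m * w) * y = m * (w * y) - w * (m * y) := mul_mul_eq m w y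
      rw [e1, e2]
      exact ⟨sub_mem (step _ h2.1) h1.1, sub_mem (step _ h2.2) h1.2⟩

theorem mul_mem_oneOf_of_null [FiniteDimensional K L] {m y z : L} (hy : y ∈ nullOf (K := K) m)
    (hz : z ∈ oneOf (K := K) m) : y * z ∈ oneOf (K := K) m ∧ z * y ∈ oneOf (K := K) m := by
  obtain ⟨n, hn⟩ := mem_nullOf.1 hy
  have h k := mul_mem_range_of_null_of_one n k y z hn hz
  exact ⟨(Submodule.mem_iInf _).2 fun k => (h k).1, (Submodule.mem_iInf _).2 fun k => (h k).2⟩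

/-! ### Engel's argument. -/

/-- An Engel-type lemma: if a nilpotent subalgebra `M` acts on an invariant subspace `V` by
nilpotent left multiplications, then it has a nonzero fixed line in `V / (V ⊓ M)`. -/
theorem exists_mul_mem_of_nil [FiniteDimensional K L] {M : NonUnitalSubalgebra K L}
    (hM : IsNilpotent M.toSubmodule) {V : Submodule K L} (hV : ∀ m ∈ M, ∀ v ∈ V, m * v ∈ V)
    (hVM : ¬ V ≤ M.toSubmodule) (hnil : ∀ m ∈ M, nullOf (K := K) m = ⊤) :
    ∃ x ∈ V, x ∉ M ∧ ∀ m ∈ M, m * x ∈ M := by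
  let P : Submodule K L → Prop := fun U =>
    U ≤ M.toSubmodule ∧ ∃ x ∈ V, x ∉ M ∧ ∀ u ∈ U, u * x ∈ M
  have hP : ∃ U, P U := by
    obtain ⟨x, hx, hxM⟩ := SetLike.not_le_iff_exists.1 hVM
    refine ⟨⊥, bot_le, x, hx, hxM, fun u hu => ?_⟩
    rw [(Submodule.mem_bot K).1 hu, zero_mul]
    exact zero_mem _
  -- Choose a largest subspace U of M that sends some y ∈ V outside M into M.
  obtain ⟨U, ⟨hUM, y, hyV, hyM, hy⟩, hmax⟩ := wellFounded_gt.has_min {U | P U} hP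
  by_cases hMU : M.toSubmodule ≤ U
  · exact ⟨y, hyV, hyM, fun m hm => hy m (hMU hm)⟩
  exfalso
  -- Take m in the last term of the lower central series of M not inside U; the next term absorbs
  -- Um.
  obtain ⟨m, hmM, hmU, hUm⟩ : ∃ m ∈ M, m ∉ U ∧ ∀ u ∈ U, u * m ∈ U := by
    have hex : ∃ n, lowerCentral M.toSubmodule n ≤ U := by
      obtain ⟨n, hn⟩ := hM
      exact ⟨n, hn ▸ bot_le⟩
    have hle : ∀ k, lowerCentral M.toSubmodule k ≤ M.toSubmodule := by
      intro k
      induction k with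
      | zero => exact le_rfl
      | succ k ih => exact prod_le.2 fun u hu v hv => M.mul_mem hu (ih hv)
    obtain ⟨n, hn, h1⟩ := Nat.exists_not_and_succ_of_not_zero_of_exists hMU hex
    obtain ⟨m, hm, hmU⟩ := SetLike.not_le_iff_exists.1 hn
    exact ⟨m, hle n hm, hmU, fun u hu => h1 (mul_mem_prod (hUM hu) hm)⟩
  have hex : ∃ k, (LinearMap.mulLeft K m ^ k) y ∈ M := by
    obtain ⟨k, hk⟩ := mem_nullOf.1 (hnil m hmM ▸ Submodule.mem_top : y ∈ nullOf (K := K) m)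
    exact ⟨k, hk ▸ zero_mem _⟩
  have hiter : ∀ k, (LinearMap.mulLeft K m ^ k) y ∈ V ∧
      ∀ u ∈ U, u * (LinearMap.mulLeft K m ^ k) y ∈ M := by
    intro k
    induction k with
    | zero => exact ⟨by simpa using hyV, by simpa using hy⟩
    | succ k ih =>
      rw [pow_succ', Module.End.mul_apply, LinearMap.mulLeft_apply]
      refine ⟨hV m hmM _ ih.1, fun u hu => ?_⟩
      rw [IsLeftLeibniz.leibniz]
      exact add_mem (ih.2 _ (hUm u hu)) (M.mul_mem hmM (ih.2 u hu))
  -- The last iterate ℓ_m^k(y) outside M serves for U + Km, against maximality.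
  obtain ⟨k, h2, h1⟩ := Nat.exists_not_and_succ_of_not_zero_of_exists
    (p := fun k => (LinearMap.mulLeft K m ^ k) y ∈ M) (by simpa using hyM) hex
  rw [pow_succ', Module.End.mul_apply, LinearMap.mulLeft_apply] at h1
  refine hmax (U ⊔ Submodule.span K {m}) ⟨sup_le hUM ?_, _, (hiter k).1, h2, ?_⟩ ?_
  · exact (Submodule.span_singleton_le_iff_mem _ _).2 hmM
  · intro v hv
    obtain ⟨u, hu, w, hw, rfl⟩ := Submodule.mem_sup.1 hv
    obtain ⟨c, rfl⟩ := Submodule.mem_span_singleton.1 hw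
    rw [add_mul, smul_mul_assoc]
    exact add_mem ((hiter k).2 u hu) (M.toSubmodule.smul_mem c h1)
  · refine lt_of_le_of_ne le_sup_left fun e => hmU ?_
    rw [e]
    exact Submodule.mem_sup_right (Submodule.mem_span_singleton_self m)

/-- Otherwise Engel yields x ∉ M with Mx ≤ M. Also xM ≤ M, contradicting self-normalization: if
Leib(L) ≤ M, then xm ≡ -mx modulo M; if not, x can be taken in Leib(L), where xM = 0. -/
theorem exists_nullOf_ne_top [FiniteDimensional K L] {M : NonUnitalSubalgebra K L}
    (hM : IsNilpotent M.toSubmodule) (htop : M ≠ ⊤) (hself : IsSelfNormalizing M) :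
    ∃ m ∈ M, nullOf (K := K) m ≠ ⊤ := by
  by_contra! hnil
  have hnorm : ∀ x, (∀ m ∈ M, x * m ∈ M ∧ m * x ∈ M) → x ∈ M := fun x hx => by
    have : x ∈ normalizer M := hx
    rwa [hself] at this
  by_cases h : leib K L ≤ M.toSubmodule
  · have ht : ¬ (⊤ : Submodule K L) ≤ M.toSubmodule := fun h =>
      htop (eq_top_iff.2 fun x _ => h Submodule.mem_top)
    obtain ⟨x, -, hxM, hx⟩ := exists_mul_mem_of_nil hM (fun _ _ _ _ => Submodule.mem_top) ht hnil
    refine hxM (hnorm x fun m hm => ⟨?_, hx m hm⟩)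
    rw [← add_sub_cancel_right (x * m) (m * x)]
    exact sub_mem (h (mul_add_mul_mem_leib x m)) (hx m hm)
  · obtain ⟨x, hxL, hxM, hx⟩ := exists_mul_mem_of_nil hM
      (fun m _ v hv => (isIdeal_leib K L m v hv).1) h hnil
    refine hxM (hnorm x fun m hm => ⟨?_, hx m hm⟩)
    rw [leib_mul hxL]
    exact zero_mem _

/-! ### Ideals relative to a maximal subalgebra. -/

/-- If `M` is a maximal subalgebra and `B` is an ideal not contained in `M` with
`[B, B] ≤ M`, then `B ⊓ M` lies in the core. -/
theorem inf_le_core {M : NonUnitalSubalgebra K L} (hM : IsCoatom M) {B : Submodule K L}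
    (hB : IsIdeal B) (hBM : ¬ B ≤ M.toSubmodule) (hBB : prod B B ≤ M.toSubmodule) :
    B ⊓ M.toSubmodule ≤ core M := by
  refine le_core ?_ inf_le_right
  rintro x a ⟨haB, haM⟩
  refine ⟨⟨(hB x a haB).1, ?_⟩, ⟨(hB x a haB).2, ?_⟩⟩ <;>
    obtain ⟨b, hb, c, hc, rfl⟩ := Submodule.mem_sup.1
      (hB.sup_eq_top hM hBM ▸ Submodule.mem_top : x ∈ B ⊔ M.toSubmodule)
  · rw [add_mul]
    exact add_mem (hBB (mul_mem_prod hb haB)) (M.mul_mem hc haM)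
  · rw [mul_add]
    exact add_mem (hBB (mul_mem_prod haB hb)) (M.mul_mem haM hc)

theorem leib_inf_le_core {M : NonUnitalSubalgebra K L} (hM : IsCoatom M) :
    leib K L ⊓ M.toSubmodule ≤ core M := by
  by_cases h : leib K L ≤ M.toSubmodule
  · exact inf_le_left.trans (le_core (isIdeal_leib K L) h)
  · refine inf_le_core hM (isIdeal_leib K L) h (prod_le.2 fun u hu v _ => ?_)
    rw [leib_mul hu]
    exact zero_mem _

/-- Add to the core the last derived term of L not inside M; the next term is an ideal inside M,
hence in the core. -/
theorem exists_isIdeal_prod_le_core (hsol : IsSolvable (⊤ : Submodule K L))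
    {M : NonUnitalSubalgebra K L} (hM : IsCoatom M) :
    ∃ B : Submodule K L, IsIdeal B ∧ core M ≤ B ∧ ¬ B ≤ M.toSubmodule ∧ prod B B ≤ core M := by
  have hex : ∃ n, derived (⊤ : Submodule K L) n ≤ M.toSubmodule := by
    obtain ⟨n, hn⟩ := hsol
    exact ⟨n, hn ▸ bot_le⟩
  have h0 : ¬ derived (⊤ : Submodule K L) 0 ≤ M.toSubmodule := fun h =>
    hM.1 (eq_top_iff.2 fun x _ => h (Submodule.mem_top : x ∈ (⊤ : Submodule K L)))
  obtain ⟨n, h2, h1⟩ := Nat.exists_not_and_succ_of_not_zero_of_exists h0 hex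
  have h3 := le_core (isIdeal_derived K L (n + 1)) h1
  have hN := isIdeal_core M
  refine ⟨core M ⊔ derived ⊤ n, hN.sup (isIdeal_derived K L n), le_sup_left,
    fun h => h2 (le_sup_right.trans h), prod_le.2 fun u hu v hv => ?_⟩
  obtain ⟨a, ha, b, hb, rfl⟩ := Submodule.mem_sup.1 hu
  obtain ⟨c, hc, d, hd, rfl⟩ := Submodule.mem_sup.1 hv
  rw [add_mul, mul_add b]
  exact add_mem (hN _ _ ha).2 (add_mem (hN _ _ hc).1 (h3 (mul_mem_prod hb hd)))

end

end Leibniz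

/-! ### The main theorem. -/

open Leibniz in
theorem mainTheorem3 {K L : Type*} [Field K] [NonUnitalNonAssocRing L] [Module K L]
    [IsScalarTower K L L] [SMulCommClass K L L] [IsLeftLeibniz L] [FiniteDimensional K L]
    (hL : Leibniz.IsMinimalNonnilpotent K L)
    (M : NonUnitalSubalgebra K L) (hmax : IsCoatom M) (hself : Leibniz.IsSelfNormalizing M)
    (N L₁ A : Submodule K L) (hN : N = Leibniz.core M) (hL₁ : L₁ = Leibniz.fittingOne M)
    (hA : A = N ⊔ L₁) :
    (Leibniz.fittingNull M = M.toSubmodule ∧ IsCompl M.toSubmodule L₁) ∧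
    (∃ F : Submodule K L, Module.finrank K F = 1 ∧
      DirectSum.IsInternal ![N, L₁, F] ∧
      Disjoint N F ∧ N ⊔ F = M.toSubmodule) ∧
    Disjoint N L₁ ∧ Leibniz.IsIdeal A ∧
    Leibniz.prod A (Leibniz.prod A A) ≤ Leibniz.leib K L := by
  have hMnil := hL.nilpotent_of_proper M hmax.1
  obtain ⟨k, hk⟩ := id hMnil
  have hkM : ∀ x ∈ M, ∀ y ∈ M, (LinearMap.mulLeft K x ^ k) y = 0 := fun x hx y hy => by
    have h := mulLeft_pow_mem_lowerCentral (U := M.toSubmodule) hx hy k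
    rwa [hk, Submodule.mem_bot] at h
  have hMnull : ∀ x ∈ M, M.toSubmodule ≤ nullOf x := fun x hx y hy =>
    mem_nullOf.2 ⟨k, hkM x hx y hy⟩
  obtain ⟨m, hm, hmtop⟩ := exists_nullOf_ne_top hMnil hmax.1 hself
  have hnull : nullOf m = M.toSubmodule := by
    refine le_antisymm ?_ (hMnull m hm)
    by_contra h
    have hlt : M < nullSubalgebra K m :=
      lt_of_le_of_ne (fun x hx => hMnull m hm hx) fun e => h fun x hx => by
        change x ∈ M
        rw [e]
        exact hx
    have ht := hmax.2 _ hlt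
    refine hmtop (eq_top_iff.2 fun x _ => ?_)
    have hx : x ∈ nullSubalgebra K m := ht ▸ NonUnitalAlgebra.mem_top
    exact hx
  have hcompl := isCompl_nullOf_oneOf (K := K) m
  rw [hnull] at hcompl
  have hLm : L₁ = oneOf m := by
    rw [hL₁]
    refine le_antisymm (iSup_le fun x => ?_) (le_iSup_of_le ⟨m, hm⟩ le_rfl)
    -- Each x ∈ M preserves the one-component of m and is nilpotent on its complement M.
    exact oneOf_le (hcompl.symm.sup_eq_top)
      (fun b hb => (mul_mem_oneOf_of_null (hnull ▸ x.2) hb).1) (hkM x x.2)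
  rw [← hLm] at hcompl
  have hML : ∀ x ∈ M, ∀ y ∈ L₁, x * y ∈ L₁ ∧ y * x ∈ L₁ := fun x hx y hy => by
    rw [hLm] at hy ⊢
    exact mul_mem_oneOf_of_null (hnull ▸ hx) hy
  have hMtop : M.toSubmodule ≠ ⊤ := fun h => hmax.1 (eq_top_iff.2 fun x _ => by
    change x ∈ M.toSubmodule
    rw [h]
    exact Submodule.mem_top)
  have hN_ideal : IsIdeal N := hN ▸ isIdeal_core M
  have hNM : N ≤ M.toSubmodule := hN ▸ core_le M
  have hNL : Disjoint N L₁ := hcompl.disjoint.mono_left hNM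
  -- Both products lie in the ideal N and, as N ≤ M, in L₁.
  have hzero : ∀ n ∈ N, ∀ y ∈ L₁, n * y = 0 ∧ y * n = 0 := fun n hn y hy =>
    ⟨Submodule.disjoint_def.1 hNL _ (hN_ideal y n hn).2 (hML n (hNM hn) y hy).1,
      Submodule.disjoint_def.1 hNL _ (hN_ideal y n hn).1 (hML n (hNM hn) y hy).2⟩
  -- A subalgebra that contains `L₁` and an element acting on `L₁` like `m` is everything.
  have hgen : ∀ (S : NonUnitalSubalgebra K L) (x : L), x ∈ S → L₁ ≤ S.toSubmodule →
      (∀ y ∈ L₁, x * y = m * y) → S = ⊤ := by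
    intro S x hx hS hxm
    by_contra h
    obtain ⟨j, hj⟩ := hL.nilpotent_of_proper S h
    refine hMtop ?_
    have hL0 : L₁ = ⊥ := by
      refine (Submodule.eq_bot_iff _).2 fun y hy => ?_
      have h1 := mulLeft_pow_mem_lowerCentral (U := S.toSubmodule) hx (hS hy) j
      rw [hj, Submodule.mem_bot] at h1
      have h2 : ∀ i, (LinearMap.mulLeft K m ^ i) y ∈ L₁ ∧
          (LinearMap.mulLeft K x ^ i) y = (LinearMap.mulLeft K m ^ i) y := by
        intro i
        induction i with
        | zero => simpa using hy
        | succ i ih =>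
          simp only [pow_succ', Module.End.mul_apply, LinearMap.mulLeft_apply]
          exact ⟨(hML m hm _ ih.1).1, by rw [ih.2, hxm _ ih.1]⟩
      rw [(h2 j).2] at h1
      have h3 : y ∈ M.toSubmodule := hnull ▸ mem_nullOf.2 ⟨j, h1⟩
      exact Submodule.disjoint_def.1 hcompl.disjoint y h3 hy
    have h4 := hcompl.sup_eq_top
    rwa [hL0, sup_bot_eq] at h4
  obtain ⟨B, hB, hNB, hBM, hBB⟩ := exists_isIdeal_prod_le_core hL.solvable hmax
  rw [← hN] at hNB hBB
  have hBMN : B ⊓ M.toSubmodule ≤ N := hN ▸ inf_le_core hmax hB hBM (hBB.trans hNM)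
  have hLB : L₁ ≤ B := hLm ▸ oneOf_le (hB.sup_eq_top hmax hBM)
    (fun b hb => (hB m b hb).1) (hkM m hm)
  have hAB : A = B := by
    rw [hA]
    refine le_antisymm (sup_le hNB hLB) fun b hb => ?_
    obtain ⟨x, hx, y, hy, rfl⟩ := Submodule.mem_sup.1
      (hcompl.sup_eq_top ▸ Submodule.mem_top : b ∈ M.toSubmodule ⊔ L₁)
    refine Submodule.add_mem_sup (hBMN ⟨?_, hx⟩) hy
    simpa using sub_mem hb (hLB hy)
  subst hAB
  have hmm : m * m ∈ leib K L := Submodule.subset_span ⟨m, rfl⟩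
  have hmmN : m * m ∈ N := hN ▸ leib_inf_le_core hmax ⟨hmm, M.mul_mem hm hm⟩
  have hAm : A ⊔ Submodule.span K {m} = ⊤ := by
    have h := hgen (hB.supSpanSubalgebra m (hNB hmmN)) m
      ((le_sup_right : _ ≤ A ⊔ Submodule.span K {m}) (Submodule.mem_span_singleton_self m))
      (hLB.trans (le_sup_left : A ≤ A ⊔ Submodule.span K {m})) fun _ _ => rfl
    refine eq_top_iff.2 fun x _ => ?_
    have hx : x ∈ hB.supSpanSubalgebra m (hNB hmmN) := h ▸ NonUnitalAlgebra.mem_top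
    exact hx
  have hmN : m ∉ N := fun h => by
    have hL0 : L₁ = ⊥ := (Submodule.eq_bot_iff _).2 fun y hy => by
      have h1 : y ∈ M.toSubmodule := hnull ▸ mem_nullOf.2 ⟨1, by simpa using (hzero m h y hy).1⟩
      exact Submodule.disjoint_def.1 hcompl.disjoint y h1 hy
    have h4 := hcompl.sup_eq_top
    rw [hL0, sup_bot_eq] at h4
    exact hMtop h4
  have hm0 : m ≠ 0 := fun h => hmN (h ▸ zero_mem N)
  have hFM : Submodule.span K {m} ≤ M.toSubmodule :=
    (Submodule.span_singleton_le_iff_mem _ _).2 hm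
  have hNF : Disjoint N (Submodule.span K {m}) := (Submodule.disjoint_span_singleton' hm0).2 hmN
  have hNFM : N ⊔ Submodule.span K {m} = M.toSubmodule := by
    refine le_antisymm (sup_le hNM hFM) fun x hx => ?_
    obtain ⟨a, ha, b, hb, rfl⟩ := Submodule.mem_sup.1
      (hAm ▸ Submodule.mem_top : x ∈ A ⊔ Submodule.span K {m})
    refine Submodule.add_mem_sup (hBMN ⟨ha, ?_⟩) hb
    simpa using sub_mem hx (hFM hb)
  -- The left annihilator C of N contains L₁ and mm, so C + Km = L.
  have hNN : ∀ n ∈ N, ∀ n' ∈ N, n * n' = 0 := by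
    let C := leftAnnihilator N
    have hC : IsIdeal C := hN_ideal.leftAnnihilator
    have hLC : L₁ ≤ C := fun y hy n hn => (hzero n hn y hy).2
    have hmC : m * m ∈ C := fun n _ => leib_mul hmm n
    have hCm := hgen (hC.supSpanSubalgebra m hmC) m
      ((le_sup_right : _ ≤ C ⊔ Submodule.span K {m}) (Submodule.mem_span_singleton_self m))
      (hLC.trans (le_sup_left : C ≤ C ⊔ Submodule.span K {m})) fun _ _ => rfl
    intro n hn
    have hn' : n ∈ hC.supSpanSubalgebra m hmC := hCm ▸ NonUnitalAlgebra.mem_top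
    obtain ⟨c, hc, w, hw, hcw⟩ := Submodule.mem_sup.1 (show n ∈ C ⊔ Submodule.span K {m} from hn')
    obtain ⟨α, rfl⟩ := Submodule.mem_span_singleton.1 hw
    by_cases hα : α = 0
    · rw [hα, zero_smul, add_zero] at hcw
      exact hcw ▸ hc
    let CS : NonUnitalSubalgebra K L := { C with mul_mem' := fun {a b} _ hb => (hC a b hb).1 }
    have hmc : m = α⁻¹ • n - α⁻¹ • c := by
      rw [← smul_sub, ← hcw, add_sub_cancel_left, smul_smul, inv_mul_cancel₀ hα, one_smul]
    -- Since n kills L₁, -α⁻¹c acts on L₁ like m, so C itself is L.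
    have hCS : CS = ⊤ := hgen CS (-(α⁻¹ • c)) (C.neg_mem (C.smul_mem _ hc)) hLC fun y hy => by
      conv_rhs => rw [hmc]
      rw [sub_mul, smul_mul_assoc, (hzero n hn y hy).1, smul_zero, zero_sub, neg_mul]
    have h : n ∈ CS := hCS ▸ NonUnitalAlgebra.mem_top
    exact h
  refine ⟨⟨le_antisymm ?_ ?_, hcompl⟩, ⟨Submodule.span K {m}, finrank_span_singleton hm0, ?_, hNF,
    hNFM⟩, hNL, hB, ?_⟩
  · have h : fittingNull M ≤ nullOf (K := K) m := fun y hy => (Submodule.mem_iInf _).1 hy ⟨m, hm⟩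
    exact hnull ▸ h
  · exact le_iInf fun x => hMnull x x.2
  · refine isInternal_of_disjoint_of_sup_eq_top hNF (hNFM ▸ hcompl.disjoint) ?_
    rw [← hA, hAm]
  · refine prod_le.2 fun a ha b hb => ?_
    rw [hA] at ha
    obtain ⟨n, hn, y, hy, rfl⟩ := Submodule.mem_sup.1 ha
    rw [add_mul, hNN n hn b (hBB hb), (hzero b (hBB hb) y hy).2, add_zero]
    exact zero_mem _
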